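/- Let $\mathbb D$ be the open unit disk, $\mathbb T$ the unit circle, $H^\infty$ the space of bounded analytic functions on $\mathbb D$ with the supremum norm $\|\cdot\|_\infty$, and $\rho(a,z)=\left|\frac{z-a}{1-\overline a z}\right|$ the pseudohyperbolic distance. Let $(a_n)_{n\ge1}$ be a sequence in $\mathbb D$ with $\sum_n(1-|a_n|)<\infty$, let $\lambda\in\mathbb T$, and let $$B(z)=\lambda\prod_{n=1}^\infty\frac{|a_n|}{-a_n}\,\frac{z-a_n}{1-\overline{a_n}z}$$ be a Blaschke product with zero sequence $(a_n)$ (where $|a_n|/a_n:=1$ if $a_n=0$). Let $K_B^\infty=H^\infty\cap B\,\overline{zH^\infty}$, that is, the set of all $f\in H^\infty$ for which there is $g\in H^\infty$ with $f(\zeta)=B(\zeta)\,\overline{\zeta g(\zeta)}$ for almost every $\zeta\in\mathbb T$ (in the sense of radial boundary values). A sequence $(w_n)$ in $\mathbb D$ is called interpolating for $K_B^\infty$ if for every bounded sequence $(\alpha_n)$ of complex numbers there is $f\in K_B^\infty$ with $f(w_n)=\alpha_n$ for all $n$. Suppose that $(a_n)$ is interpolating for $K_B^\infty$. Then there is a constant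 $M$ such that $$\|f\|_\infty\le M\,\sup_n|f(a_n)|\qquad\text{for every } f\in K_B^\infty. \tag{$*$}$$ Moreover, for every constant $M$ satisfying $(*)$, every real $\varepsilon$, and every sequence $(z_n)$ of distinct points of $\mathbb D$ with $\rho(a_n,z_n)<1-\varepsilon<1/(2M)$ for all $n$, the sequence $(z_n)$ is interpolating for $K_B^\infty$. -/

import Mathlib

open Filter Topology MeasureTheory

noncomputable section

/-- `f` belongs to `H^∞`: it is analytic and bounded on the open unit disk
(its values outside the disk are irrelevant). -/
def IsHInf (f : ℂ → ℂ) : Prop :=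
  DifferentiableOn ℂ f (Metric.ball 0 1) ∧
    ∃ C : ℝ, ∀ z ∈ Metric.ball (0 : ℂ) 1, ‖f z‖ ≤ C

/-- The supremum norm over the open unit disk (meaningful for `f` in `H^∞`). -/
def hInfNorm (f : ℂ → ℂ) : ℝ :=
  ⨆ z : Metric.ball (0 : ℂ) 1, ‖f z‖

/-- `f` has the radial limit `w` at the boundary point `ζ`. -/
def HasRadialLimit (f : ℂ → ℂ) (ζ w : ℂ) : Prop :=
  Tendsto (fun r : ℝ => f ((r : ℂ) * ζ)) (𝓝[<] (1 : ℝ)) (𝓝 w)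

/-- The space `K_θ^∞ = H^∞ ∩ θ · conj (z H^∞)`. As usual, functions on the disk are identified
with their boundary functions: `f ∈ H^∞` belongs to it when there is `g ∈ H^∞` such that
`f ζ = θ ζ * conj (ζ * g ζ)` for almost every `ζ = exp (i t)` on the unit circle, the boundary
values being radial limits. -/
def modelSpaceInf (θ : ℂ → ℂ) : Set (ℂ → ℂ) :=
  {f | IsHInf f ∧ ∃ g : ℂ → ℂ, IsHInf g ∧
    ∀ᵐ t : ℝ ∂volume, ∃ u b v : ℂ,
      HasRadialLimit f (Complex.exp (t * Complex.I)) u ∧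
      HasRadialLimit θ (Complex.exp (t * Complex.I)) b ∧
      HasRadialLimit g (Complex.exp (t * Complex.I)) v ∧
      u = b * (starRingEnd ℂ) (Complex.exp (t * Complex.I) * v)}

/-- The Blaschke factor `(|a| / (-a)) * (z - a) / (1 - conj a * z)`, where `|a| / a` is
interpreted as `1` for `a = 0`. -/
def blaschkeFactor (a z : ℂ) : ℂ :=
  (if a = 0 then -1 else (‖a‖ : ℂ) / (-a)) * ((z - a) / (1 - (starRingEnd ℂ) a * z))

/-- The Blaschke product with zero sequence `a` and unimodular constant `c`. (When
`∑ (1 - |a n|) < ∞`, the product converges absolutely at every point of the disk.) -/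
def blaschkeProduct (c : ℂ) (a : ℕ → ℂ) (z : ℂ) : ℂ :=
  c * ∏' n, blaschkeFactor (a n) z

/-- The pseudohyperbolic distance. -/
def pseudoDist (a z : ℂ) : ℝ :=
  ‖(z - a) / (1 - (starRingEnd ℂ) a * z)‖

/-- The sequence `a` is interpolating for the function space `X`: every bounded sequence is the
sequence of values on `a` of some member of `X`. -/
def IsInterpolatingFor (X : Set (ℂ → ℂ)) (a : ℕ → ℂ) : Prop :=
  ∀ α : ℕ → ℂ, (∃ C : ℝ, ∀ n, ‖α n‖ ≤ C) → ∃ f ∈ X, ∀ n, f (a n) = α n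

/-- `M` satisfies `‖f‖_∞ ≤ M * ‖(f (a n))‖_∞` for every `f ∈ X`. -/
def IsBoundedInverseConst (X : Set (ℂ → ℂ)) (a : ℕ → ℂ) (M : ℝ) : Prop :=
  ∀ f ∈ X, hInfNorm f ≤ M * ⨆ n, ‖f (a n)‖

end

/-! Evaluation along `(a_n)` is a bounded operator `T` from `K_B^∞`, with the supremum norm, to
`ℓ^∞`. The interpolation hypothesis says that `T` is onto. If `T` is also injective and its domain
is complete, the open mapping theorem bounds the inverse of `T`, which is the constant `M`. By
Schwarz–Pick, evaluation along `(z_n)` differs from `T f` by at most `2(1 - ε)‖f‖ ≤ 2(1 - ε)M‖T f‖`.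
Since `2(1 - ε)M < 1`, a Neumann series (`surjective_of_norm_sub_le`) makes the perturbed evaluation
onto.

Injectivity (`eq_zero_of_mem_modelSpaceInf_blaschkeProduct`): let `f = B·conj(ζg)` on the circle
vanish at every `a_n`. Split `B` into a finite product `P_N` and a tail `B_N`, and write `f = P_N
h`. Then `h·(zg)` has boundary values `B_N|g|²` and vanishes at `0`, so `∫ B_N|g|² = 0`. Hence
`∫|g|² = ∫(1 - Re B_N)|g|² ≤ ‖g‖²(1 - Re B_N(0))`, which tends to `0`.

Completeness (`modelSpaceInf_of_tendstoUniformlyOn`): `|B| = 1` almost everywhere on the circle, so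
`f` and `g` have the same boundary modulus and uniform convergence of the `f`'s passes to the `g`'s.
Fatou's theorem is never needed, because membership in `K_B^∞` supplies the radial limits. -/

open Filter Topology MeasureTheory

noncomputable section

/-! ### Arc length and radial limits. -/

/-- The normalised arc length measure on the unit circle, in the parametrisation
`t ↦ exp (i t)` with `0 < t ≤ 2 π`. -/
def arcMeasure : Measure ℝ :=
  (ENNReal.ofReal (2 * Real.pi))⁻¹ • volume.restrict (Set.Ioc 0 (2 * Real.pi))

instance : IsProbabilityMeasure arcMeasure := by
  constructor
  have h : ENNReal.ofReal (2 * Real.pi) ≠ 0 := by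
    simp [Real.pi_pos]
  simp only [arcMeasure, Measure.smul_apply, Measure.restrict_apply MeasurableSet.univ,
    Set.univ_inter, Real.volume_Ioc, sub_zero, smul_eq_mul]
  exact ENNReal.inv_mul_cancel h ENNReal.ofReal_ne_top

lemma ae_arcMeasure_of_ae {p : ℝ → Prop} (h : ∀ᵐ t : ℝ, p t) : ∀ᵐ t ∂arcMeasure, p t :=
  Measure.ae_smul_measure (ae_restrict_of_ae h) _

lemma circleAverage_eq_integral_arcMeasure (f : ℂ → ℂ) (r : ℝ) :
    Real.circleAverage f 0 r = ∫ t : ℝ, f (r * Complex.exp (t * Complex.I)) ∂arcMeasure := by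
  rw [arcMeasure, integral_smul_measure, Real.circleAverage,
    intervalIntegral.integral_of_le (by positivity), ENNReal.toReal_inv,
    ENNReal.toReal_ofReal (by positivity)]
  simp [circleMap]

/-- The function `v` gives the radial limits of `f` almost everywhere on the unit circle. -/
def HasBoundaryValues (f : ℂ → ℂ) (v : ℝ → ℂ) : Prop :=
  ∀ᵐ t : ℝ ∂arcMeasure, HasRadialLimit f (Complex.exp (t * Complex.I)) (v t)

lemma HasBoundaryValues.ae {f : ℂ → ℂ} {v : ℝ → ℂ} (h : HasBoundaryValues f v) :
    ∀ᵐ t : ℝ ∂arcMeasure, HasRadialLimit f (Complex.exp (t * Complex.I)) (v t) := h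

lemma HasRadialLimit.tendsto {f : ℂ → ℂ} {ζ u : ℂ} (h : HasRadialLimit f ζ u) :
    Tendsto (fun r : ℝ => f ((r : ℂ) * ζ)) (𝓝[<] (1 : ℝ)) (𝓝 u) := h

lemma HasRadialLimit.mul {f g : ℂ → ℂ} {ζ u v : ℂ} (hf : HasRadialLimit f ζ u)
    (hg : HasRadialLimit g ζ v) : HasRadialLimit (fun z => f z * g z) ζ (u * v) :=
  Tendsto.mul hf hg

lemma HasRadialLimit.add {f g : ℂ → ℂ} {ζ u v : ℂ} (hf : HasRadialLimit f ζ u)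
    (hg : HasRadialLimit g ζ v) : HasRadialLimit (fun z => f z + g z) ζ (u + v) :=
  Tendsto.add hf hg

lemma HasRadialLimit.sub {f g : ℂ → ℂ} {ζ u v : ℂ} (hf : HasRadialLimit f ζ u)
    (hg : HasRadialLimit g ζ v) : HasRadialLimit (fun z => f z - g z) ζ (u - v) :=
  Tendsto.sub hf hg

lemma HasRadialLimit.unique {f : ℂ → ℂ} {ζ u v : ℂ} (hu : HasRadialLimit f ζ u)
    (hv : HasRadialLimit f ζ v) : u = v :=
  tendsto_nhds_unique hu hv

lemma hasRadialLimit_of_continuousAt {f : ℂ → ℂ} {ζ : ℂ} (hf : ContinuousAt f ζ) :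
    HasRadialLimit f ζ (f ζ) := by
  have h1 : Tendsto (fun r : ℝ => (r : ℂ) * ζ) (𝓝 1) (𝓝 ζ) :=
    Continuous.tendsto' (by fun_prop) _ _ (by simp)
  exact hf.tendsto.comp (h1.mono_left nhdsWithin_le_nhds)

lemma eventually_mul_mem_ball {ζ : ℂ} (hζ : ‖ζ‖ = 1) :
    ∀ᶠ r : ℝ in 𝓝[<] 1, (r : ℂ) * ζ ∈ Metric.ball (0 : ℂ) 1 := by
  filter_upwards [Ioo_mem_nhdsLT (show (0 : ℝ) < 1 by norm_num)] with r hr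
  simp [hζ, abs_of_pos hr.1, hr.2]

lemma HasRadialLimit.norm_le {f : ℂ → ℂ} {ζ u : ℂ} (hζ : ‖ζ‖ = 1) {C : ℝ}
    (h : ∀ z ∈ Metric.ball (0 : ℂ) 1, ‖f z‖ ≤ C) (hf : HasRadialLimit f ζ u) : ‖u‖ ≤ C :=
  le_of_tendsto hf.norm ((eventually_mul_mem_ball hζ).mono fun _ hr => h _ hr)

/-! ### The algebra `H^∞`. -/

lemma IsHInf.add {f g : ℂ → ℂ} (hf : IsHInf f) (hg : IsHInf g) :
    IsHInf fun z => f z + g z := by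
  obtain ⟨hf, C, hC⟩ := hf
  obtain ⟨hg, D, hD⟩ := hg
  exact ⟨hf.add hg, C + D, fun z hz => (norm_add_le _ _).trans (add_le_add (hC z hz) (hD z hz))⟩

lemma IsHInf.mul {f g : ℂ → ℂ} (hf : IsHInf f) (hg : IsHInf g) :
    IsHInf fun z => f z * g z := by
  obtain ⟨hf, C, hC⟩ := hf
  obtain ⟨hg, D, hD⟩ := hg
  refine ⟨hf.mul hg, C * D, fun z hz => ?_⟩
  rw [norm_mul]
  exact mul_le_mul (hC z hz) (hD z hz) (norm_nonneg _) ((norm_nonneg _).trans (hC z hz))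

lemma isHInf_const (c : ℂ) : IsHInf fun _ => c :=
  ⟨differentiableOn_const c, ‖c‖, fun _ _ => le_rfl⟩

lemma isHInf_id : IsHInf fun z => z :=
  ⟨differentiableOn_id, 1, fun z hz => by simpa using (mem_ball_zero_iff.1 hz).le⟩

lemma IsHInf.const_mul {f : ℂ → ℂ} (c : ℂ) (hf : IsHInf f) : IsHInf fun z => c * f z :=
  (isHInf_const c).mul hf

lemma IsHInf.sub {f g : ℂ → ℂ} (hf : IsHInf f) (hg : IsHInf g) :
    IsHInf fun z => f z - g z := by
  simpa [sub_eq_add_neg] using hf.add (hg.const_mul (-1))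

lemma IsHInf.pow {f : ℂ → ℂ} (hf : IsHInf f) (n : ℕ) : IsHInf fun z => f z ^ n := by
  induction n with
  | zero => simpa using isHInf_const 1
  | succ n ih => simpa [pow_succ] using ih.mul hf

/-! ### Recovering a function from its boundary values. -/

lemma tendsto_one_sub_inv_nat :
    Tendsto (fun k : ℕ => 1 - ((k : ℝ) + 1)⁻¹) atTop (𝓝[<] 1) := by
  refine tendsto_nhdsWithin_iff.2 ⟨?_, Eventually.of_forall fun k => ?_⟩
  · simpa [one_div] using
      (tendsto_const_nhds (x := (1 : ℝ))).sub (tendsto_one_div_add_atTop_nhds_zero_nat (𝕜 := ℝ))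
  · have : (0 : ℝ) < ((k : ℝ) + 1)⁻¹ := by positivity
    simp only [Set.mem_Iio]; linarith

lemma continuous_radius_mul_exp (r : ℝ) :
    Continuous fun t : ℝ => (r : ℂ) * Complex.exp (t * Complex.I) := by fun_prop

lemma continuous_comp_radius {f : ℂ → ℂ} (hf : DifferentiableOn ℂ f (Metric.ball 0 1)) {r : ℝ}
    (h0 : 0 ≤ r) (h1 : r < 1) : Continuous fun t : ℝ => f (r * Complex.exp (t * Complex.I)) :=
  hf.continuousOn.comp_continuous (continuous_radius_mul_exp r) fun t => by
    simp [Complex.norm_exp_ofReal_mul_I, abs_of_nonneg h0, h1]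

lemma radius_nonneg (k : ℕ) : 0 ≤ 1 - ((k : ℝ) + 1)⁻¹ := by
  rw [sub_nonneg]
  exact inv_le_one_of_one_le₀ (by linarith [(Nat.cast_nonneg k : (0 : ℝ) ≤ k)])

lemma radius_lt_one (k : ℕ) : 1 - ((k : ℝ) + 1)⁻¹ < 1 := by
  have : (0 : ℝ) < ((k : ℝ) + 1)⁻¹ := by positivity
  linarith

/-- Boundary values are almost everywhere limits of the continuous restrictions to circles of radius
`1 - 1/(k+1)`. -/
lemma HasBoundaryValues.aestronglyMeasurable {f : ℂ → ℂ} {v : ℝ → ℂ} (hf : IsHInf f)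
    (hv : HasBoundaryValues f v) : AEStronglyMeasurable v arcMeasure := by
  refine aestronglyMeasurable_of_tendsto_ae atTop
    (f := fun (k : ℕ) (t : ℝ) => f (((1 - ((k : ℝ) + 1)⁻¹ : ℝ) : ℂ) * Complex.exp (t * Complex.I)))
    (fun k => ?_) ?_
  · exact (continuous_comp_radius hf.1 (radius_nonneg k) (radius_lt_one k)).aestronglyMeasurable
  · filter_upwards [hv.ae] with t ht
    exact ht.tendsto.comp tendsto_one_sub_inv_nat

lemma HasBoundaryValues.norm_le {f : ℂ → ℂ} {v : ℝ → ℂ} {C : ℝ}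
    (hC : ∀ z ∈ Metric.ball (0 : ℂ) 1, ‖f z‖ ≤ C) (hv : HasBoundaryValues f v) :
    ∀ᵐ t ∂arcMeasure, ‖v t‖ ≤ C := by
  filter_upwards [hv.ae] with t ht
  exact ht.norm_le (Complex.norm_exp_ofReal_mul_I t) hC

lemma HasBoundaryValues.integrable {f : ℂ → ℂ} {v : ℝ → ℂ} (hf : IsHInf f)
    (hv : HasBoundaryValues f v) : Integrable v arcMeasure := by
  obtain ⟨C, hC⟩ := hf.2
  exact .of_bound (hv.aestronglyMeasurable hf) C (hv.norm_le hC)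

/-- The Cauchy integral formula for bounded analytic functions with radial limits. -/
lemma HasBoundaryValues.cauchy_integral {f : ℂ → ℂ} {v : ℝ → ℂ} (hf : IsHInf f)
    (hv : HasBoundaryValues f v) {z : ℂ} (hz : z ∈ Metric.ball (0 : ℂ) 1) :
    ∫ t : ℝ, Complex.exp (t * Complex.I) / (Complex.exp (t * Complex.I) - z) * v t ∂arcMeasure
      = f z := by
  obtain ⟨C, hC⟩ := hf.2
  have hz1 : ‖z‖ < 1 := mem_ball_zero_iff.1 hz
  set r : ℕ → ℝ := fun k => 1 - ((k : ℝ) + 1)⁻¹ with hr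
  have hr0 : ∀ k, 0 ≤ r k := radius_nonneg
  have hr1 : ∀ k, r k < 1 := radius_lt_one
  have hrt : Tendsto r atTop (𝓝[<] 1) := tendsto_one_sub_inv_nat
  have hrt' : Tendsto r atTop (𝓝 1) := hrt.mono_right nhdsWithin_le_nhds
  -- A radius strictly between `‖z‖` and `1`: once `r k > s`, the Cauchy kernel denominators stay at
  -- least `s - ‖z‖`, which gives the dominating constant.
  set s : ℝ := (1 + ‖z‖) / 2 with hs
  have hzs : ‖z‖ < s := by rw [hs]; linarith
  have hev : ∀ᶠ k in atTop, s < r k := hrt'.eventually_const_lt (by rw [hs]; linarith)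
  have hnorm : ∀ k t, ‖((r k : ℝ) : ℂ) * Complex.exp ((t : ℝ) * Complex.I)‖ = r k := by
    intro k t
    simp [Complex.norm_exp_ofReal_mul_I, abs_of_nonneg (hr0 k)]
  have hsub : ∀ k t, s < r k →
      s - ‖z‖ ≤ ‖((r k : ℝ) : ℂ) * Complex.exp ((t : ℝ) * Complex.I) - z‖ := by
    intro k t hk
    have := norm_sub_norm_le (((r k : ℝ) : ℂ) * Complex.exp ((t : ℝ) * Complex.I)) z
    rw [hnorm] at this
    linarith
  set F : ℕ → ℝ → ℂ := fun k t =>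
    ((r k : ℝ) : ℂ) * Complex.exp ((t : ℝ) * Complex.I) /
      (((r k : ℝ) : ℂ) * Complex.exp ((t : ℝ) * Complex.I) - z) *
        f (((r k : ℝ) : ℂ) * Complex.exp ((t : ℝ) * Complex.I)) with hF
  have hFint : ∀ᶠ k in atTop, ∫ t, F k t ∂arcMeasure = f z := by
    filter_upwards [hev] with k hk
    have hcl : DiffContOnCl ℂ f (Metric.ball 0 |r k|) := by
      refine DifferentiableOn.diffContOnCl (hf.1.mono ?_)
      refine Metric.closure_ball_subset_closedBall.trans ?_
      rw [abs_of_nonneg (hr0 k)]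
      exact Metric.closedBall_subset_ball (hr1 k)
    have := hcl.circleAverage_smul_div (w := z) (by
      rw [abs_of_nonneg (hr0 k)]; exact mem_ball_zero_iff.2 (hzs.trans hk))
    rw [← this, circleAverage_eq_integral_arcMeasure]
    simp [hF]
  have hlim : Tendsto (fun k => ∫ t, F k t ∂arcMeasure) atTop
      (𝓝 (∫ t : ℝ, Complex.exp (t * Complex.I) / (Complex.exp (t * Complex.I) - z) * v t
        ∂arcMeasure)) := by
    refine tendsto_integral_filter_of_dominated_convergence (fun _ => 1 / (s - ‖z‖) * C) ?_ ?_
      (integrable_const _) ?_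
    · filter_upwards [hev] with k hk
      refine Continuous.aestronglyMeasurable (Continuous.mul (Continuous.div ?_ ?_ ?_) ?_)
      · fun_prop
      · fun_prop
      · intro t ht
        have := hsub k t hk
        rw [ht, norm_zero] at this
        linarith
      · exact continuous_comp_radius hf.1 (hr0 k) (hr1 k)
    · filter_upwards [hev] with k hk
      refine Eventually.of_forall fun t => ?_
      have hC0 : ‖f (((r k : ℝ) : ℂ) * Complex.exp ((t : ℝ) * Complex.I))‖ ≤ C :=
        hC _ (by rw [mem_ball_zero_iff, hnorm]; exact hr1 k)
      simp only [hF]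
      rw [norm_mul, norm_div, hnorm]
      have h3 := hsub k t hk
      have h4 : 0 < s - ‖z‖ := by linarith
      have := (hr1 k).le
      gcongr
    · filter_upwards [hv.ae] with t ht
      have hne : Complex.exp ((t : ℝ) * Complex.I) - z ≠ 0 := by
        intro h
        rw [sub_eq_zero] at h
        rw [← h, Complex.norm_exp_ofReal_mul_I] at hz1
        exact lt_irrefl _ hz1
      have hc : Tendsto (fun k => ((r k : ℝ) : ℂ) * Complex.exp ((t : ℝ) * Complex.I)) atTop
          (𝓝 (Complex.exp ((t : ℝ) * Complex.I))) := by
        have h1 : Tendsto (fun x : ℝ => (x : ℂ) * Complex.exp ((t : ℝ) * Complex.I)) (𝓝 1)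
            (𝓝 (Complex.exp ((t : ℝ) * Complex.I))) :=
          Continuous.tendsto' (by fun_prop) _ _ (by simp)
        exact h1.comp hrt'
      exact (hc.div (hc.sub_const z) hne).mul (ht.tendsto.comp hrt)
  exact tendsto_nhds_unique (hlim.congr' hFint) tendsto_const_nhds

lemma HasBoundaryValues.integral_eq {f : ℂ → ℂ} {v : ℝ → ℂ} (hf : IsHInf f)
    (hv : HasBoundaryValues f v) : ∫ t : ℝ, v t ∂arcMeasure = f 0 := by
  rw [← hv.cauchy_integral hf (Metric.mem_ball_self one_pos)]
  simp

/-- The maximum principle for radial limits. -/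
lemma HasBoundaryValues.norm_le_of_ae {f : ℂ → ℂ} {v : ℝ → ℂ} (hf : IsHInf f)
    (hv : HasBoundaryValues f v) {C : ℝ} (hC : ∀ᵐ t ∂arcMeasure, ‖v t‖ ≤ C) {z : ℂ}
    (hz : z ∈ Metric.ball (0 : ℂ) 1) : ‖f z‖ ≤ C := by
  have hz1 : ‖z‖ < 1 := mem_ball_zero_iff.1 hz
  have hpos : 0 < 1 - ‖z‖ := by linarith
  have hC0 : 0 ≤ C := by
    obtain ⟨t, ht⟩ := hC.exists
    exact (norm_nonneg _).trans ht
  -- The Cauchy formula for `f ^ n` loses a factor `1 / (1 - ‖z‖)` that does not depend on `n`, so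
  -- comparing growth in `n` removes it.
  have hpow : ∀ n : ℕ, ‖f z‖ ^ n ≤ (1 / (1 - ‖z‖)) * C ^ n := by
    intro n
    have hvn : HasBoundaryValues (fun z => f z ^ n) (fun t => v t ^ n) := by
      filter_upwards [hv.ae] with t ht
      exact Tendsto.pow ht n
    rw [← norm_pow, ← hvn.cauchy_integral (hf.pow n) hz]
    refine (norm_integral_le_of_norm_le_const (C := (1 / (1 - ‖z‖)) * C ^ n) ?_).trans (by simp)
    filter_upwards [hC] with t ht
    rw [norm_mul, norm_div, norm_pow, Complex.norm_exp_ofReal_mul_I]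
    have := norm_sub_norm_le (Complex.exp ((t : ℝ) * Complex.I)) z
    rw [Complex.norm_exp_ofReal_mul_I] at this
    gcongr
  by_contra! hlt
  rcases hC0.eq_or_lt with h0 | h0
  · have := hpow 1
    rw [← h0] at this hlt
    simp only [pow_one, mul_zero] at this
    linarith
  · have h1 : 1 < ‖f z‖ / C := (one_lt_div h0).2 hlt
    obtain ⟨n, hn⟩ := pow_unbounded_of_one_lt (1 / (1 - ‖z‖)) h1
    rw [div_pow, lt_div_iff₀ (by positivity)] at hn
    exact absurd (hpow n) (not_le.2 hn)

/-! ### Möbius maps and Blaschke factors. -/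

/-- The sign of the right-hand side decides whether the Möbius quotient has modulus below, equal to
or at most one. -/
lemma normSq_one_sub_conj_mul_sub (a z : ℂ) :
    ‖1 - (starRingEnd ℂ) a * z‖ ^ 2 - ‖z - a‖ ^ 2 = (1 - ‖a‖ ^ 2) * (1 - ‖z‖ ^ 2) := by
  simp only [← Complex.normSq_eq_norm_sq, Complex.normSq_apply, Complex.sub_re, Complex.sub_im,
    Complex.mul_re, Complex.mul_im, Complex.conj_re, Complex.conj_im, Complex.one_re,
    Complex.one_im]
  ring

lemma one_sub_conj_mul_ne_zero {a z : ℂ} (ha : ‖a‖ < 1) (hz : ‖z‖ ≤ 1) :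
    1 - (starRingEnd ℂ) a * z ≠ 0 := by
  intro h
  rw [sub_eq_zero] at h
  have h1 : ‖(starRingEnd ℂ) a * z‖ = 1 := by rw [← h, norm_one]
  rw [norm_mul, RCLike.norm_conj] at h1
  nlinarith [norm_nonneg a, norm_nonneg z]

lemma norm_mobius_le {a z : ℂ} (ha : ‖a‖ < 1) (hz : ‖z‖ ≤ 1) :
    ‖(z - a) / (1 - (starRingEnd ℂ) a * z)‖ ≤ 1 := by
  rw [norm_div]
  refine div_le_one_of_le₀ ?_ (norm_nonneg _)
  refine (sq_le_sq₀ (norm_nonneg _) (norm_nonneg _)).1 ?_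
  have h := normSq_one_sub_conj_mul_sub a z
  have h1 : 0 ≤ 1 - ‖a‖ ^ 2 := by nlinarith [norm_nonneg a]
  have h2 : 0 ≤ 1 - ‖z‖ ^ 2 := by nlinarith [norm_nonneg z]
  have := mul_nonneg h1 h2
  linarith

lemma norm_mobius_of_norm_eq_one {a z : ℂ} (ha : ‖a‖ < 1) (hz : ‖z‖ = 1) :
    ‖(z - a) / (1 - (starRingEnd ℂ) a * z)‖ = 1 := by
  have h := normSq_one_sub_conj_mul_sub a z
  rw [hz] at h
  have h1 : ‖1 - (starRingEnd ℂ) a * z‖ = ‖z - a‖ := by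
    rw [← sq_eq_sq₀ (norm_nonneg _) (norm_nonneg _)]
    linarith
  rw [norm_div, h1, div_self]
  rw [← h1]
  exact norm_ne_zero_iff.2 (one_sub_conj_mul_ne_zero ha hz.le)

/-- The unimodular constant in a Blaschke factor. -/
def blaschkeSign (a : ℂ) : ℂ := if a = 0 then -1 else (‖a‖ : ℂ) / (-a)

lemma blaschkeFactor_eq (a z : ℂ) :
    blaschkeFactor a z = blaschkeSign a * ((z - a) / (1 - (starRingEnd ℂ) a * z)) := rfl

lemma norm_blaschkeSign (a : ℂ) : ‖blaschkeSign a‖ = 1 := by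
  unfold blaschkeSign
  split_ifs with h
  · simp
  · simp [h]

lemma norm_blaschkeFactor_le {a z : ℂ} (ha : ‖a‖ < 1) (hz : ‖z‖ ≤ 1) :
    ‖blaschkeFactor a z‖ ≤ 1 := by
  rw [blaschkeFactor_eq, norm_mul, norm_blaschkeSign, one_mul]
  exact norm_mobius_le ha hz

lemma norm_blaschkeFactor_of_norm_eq_one {a z : ℂ} (ha : ‖a‖ < 1) (hz : ‖z‖ = 1) :
    ‖blaschkeFactor a z‖ = 1 := by
  rw [blaschkeFactor_eq, norm_mul, norm_blaschkeSign, one_mul]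
  exact norm_mobius_of_norm_eq_one ha hz

lemma differentiableAt_blaschkeFactor {a z : ℂ} (ha : ‖a‖ < 1) (hz : ‖z‖ ≤ 1) :
    DifferentiableAt ℂ (blaschkeFactor a) z := by
  have h := one_sub_conj_mul_ne_zero ha hz
  change DifferentiableAt ℂ
    (fun z => blaschkeSign a * ((z - a) / (1 - (starRingEnd ℂ) a * z))) z
  fun_prop (disch := exact h)

lemma blaschkeFactor_eq_zero_iff {a z : ℂ} (ha : ‖a‖ < 1) (hz : ‖z‖ ≤ 1) :
    blaschkeFactor a z = 0 ↔ z = a := by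
  have h : blaschkeSign a ≠ 0 := norm_ne_zero_iff.1 (by rw [norm_blaschkeSign]; exact one_ne_zero)
  simp [blaschkeFactor_eq, h, one_sub_conj_mul_ne_zero ha hz, sub_eq_zero]

lemma blaschkeFactor_zero (a : ℂ) : blaschkeFactor a 0 = (‖a‖ : ℂ) := by
  rw [blaschkeFactor_eq, blaschkeSign]
  split_ifs with h
  · simp [h]
  · rw [mul_zero, sub_zero, div_one, zero_sub, div_mul_cancel₀ _ (neg_ne_zero.2 h)]

/-- The unimodular constant is chosen so that `1 - ‖a‖` splits off from the factor minus one. This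
gives convergence, uniform on smaller disks, from summability. -/
lemma norm_blaschkeFactor_sub_one_le {a z : ℂ} (ha : ‖a‖ < 1) {r : ℝ} (hz : ‖z‖ ≤ r)
    (hr : r < 1) : ‖blaschkeFactor a z - 1‖ ≤ 2 / (1 - r) * (1 - ‖a‖) := by
  have hz1 : ‖z‖ < 1 := hz.trans_lt hr
  have hden : 1 - r ≤ ‖1 - (starRingEnd ℂ) a * z‖ := by
    have := norm_sub_norm_le 1 ((starRingEnd ℂ) a * z)
    rw [norm_mul, RCLike.norm_conj, norm_one] at this
    nlinarith [norm_nonneg a, norm_nonneg z]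
  have hr0 : 0 < 1 - r := by linarith
  have hne := one_sub_conj_mul_ne_zero ha hz1.le
  rcases eq_or_ne a 0 with rfl | h
  · have h1 : ‖blaschkeFactor 0 z - 1‖ ≤ 2 := by
      refine (norm_sub_le _ _).trans ?_
      have := norm_blaschkeFactor_le ha hz1.le
      rw [norm_one]; linarith
    have h2 : 2 ≤ 2 / (1 - r) := by
      rw [le_div_iff₀ hr0]
      nlinarith [norm_nonneg z]
    simpa using h1.trans h2
  · have key : blaschkeFactor a z - 1
        = -((1 - (‖a‖ : ℂ)) * (1 + (‖a‖ : ℂ) / a * z)) / (1 - (starRingEnd ℂ) a * z) := by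
      rw [blaschkeFactor_eq, blaschkeSign, if_neg h, eq_div_iff hne]
      have hc : (starRingEnd ℂ) a = (‖a‖ : ℂ) ^ 2 / a := by
        rw [eq_div_iff h, mul_comm, Complex.mul_conj, Complex.normSq_eq_norm_sq]
        push_cast; rfl
      rw [sub_mul, mul_assoc, div_mul_cancel₀ _ hne, hc]
      field_simp
      ring
    have hn : ‖(‖a‖ : ℂ) / a‖ = 1 := by simp [h]
    have hn1 : ‖(1 - (‖a‖ : ℂ))‖ = 1 - ‖a‖ := by
      rw [← Complex.ofReal_one, ← Complex.ofReal_sub, Complex.norm_real, Real.norm_eq_abs,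
        abs_of_pos (by linarith)]
    have h2 : ‖1 + (‖a‖ : ℂ) / a * z‖ ≤ 2 := by
      refine (norm_add_le _ _).trans ?_
      rw [norm_mul, hn, norm_one]; linarith
    rw [key, norm_div, norm_neg, norm_mul, hn1, div_le_iff₀ (hr0.trans_le hden)]
    have h3 : 0 ≤ 1 - ‖a‖ := by linarith
    calc (1 - ‖a‖) * ‖1 + (‖a‖ : ℂ) / a * z‖ ≤ (1 - ‖a‖) * 2 := by gcongr
      _ = 2 / (1 - r) * (1 - ‖a‖) * (1 - r) := by field_simp
      _ ≤ _ := by gcongr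

/-! ### Infinite Blaschke products, their tails and their boundary modulus. -/

section InfiniteProduct

variable {a : ℕ → ℂ}

lemma multipliable_blaschkeFactor (ha : ∀ n, ‖a n‖ < 1) (hs : Summable fun n => 1 - ‖a n‖)
    {z : ℂ} (hz : ‖z‖ < 1) : Multipliable fun n => blaschkeFactor (a n) z := by
  have h := multipliable_one_add_of_summable (f := fun n => blaschkeFactor (a n) z - 1)
    (Summable.of_nonneg_of_le (fun _ => norm_nonneg _)
      (fun n => norm_blaschkeFactor_sub_one_le (ha n) le_rfl hz) (hs.mul_left _))
  simpa using h

lemma norm_tprod_blaschkeFactor_le (ha : ∀ n, ‖a n‖ < 1) (hs : Summable fun n => 1 - ‖a n‖)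
    {z : ℂ} (hz : ‖z‖ < 1) : ‖∏' n, blaschkeFactor (a n) z‖ ≤ 1 := by
  refine le_of_tendsto (multipliable_blaschkeFactor ha hs hz).hasProd.norm
    (Eventually.of_forall fun s => ?_)
  exact Finset.prod_le_one (fun _ _ => norm_nonneg _)
    fun n _ => norm_blaschkeFactor_le (ha n) hz.le

lemma differentiableOn_tprod_blaschkeFactor (ha : ∀ n, ‖a n‖ < 1)
    (hs : Summable fun n => 1 - ‖a n‖) :
    DifferentiableOn ℂ (fun z => ∏' n, blaschkeFactor (a n) z) (Metric.ball 0 1) := by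
  intro z hz
  obtain ⟨r, hzr, hr⟩ := exists_between (mem_ball_zero_iff.1 hz)
  have hsub : ∀ w ∈ Metric.ball (0 : ℂ) r, ‖w‖ ≤ r := fun w hw => (mem_ball_zero_iff.1 hw).le
  have hd : ∀ n, DifferentiableOn ℂ (blaschkeFactor (a n)) (Metric.ball 0 r) := fun n w hw =>
    (differentiableAt_blaschkeFactor (ha n)
      ((hsub w hw).trans hr.le)).differentiableWithinAt
  have h := Summable.hasProdLocallyUniformlyOn_nat_one_add (K := Metric.ball (0 : ℂ) r)
    (f := fun n z => blaschkeFactor (a n) z - 1) Metric.isOpen_ball (hs.mul_left (2 / (1 - r)))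
    (Eventually.of_forall fun n w hw => norm_blaschkeFactor_sub_one_le (ha n) (hsub w hw) hr)
    (fun n => (hd n).continuousOn.sub continuousOn_const)
  simp only [add_sub_cancel] at h
  have h2 := h.differentiableOn (.of_forall fun s => by
    simpa [Finset.prod_fn] using DifferentiableOn.finsetProd (fun n _ => hd n)) Metric.isOpen_ball
  exact (h2.differentiableAt
    (Metric.isOpen_ball.mem_nhds (mem_ball_zero_iff.2 hzr))).differentiableWithinAt

lemma isHInf_tprod_blaschkeFactor (ha : ∀ n, ‖a n‖ < 1) (hs : Summable fun n => 1 - ‖a n‖) :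
    IsHInf fun z => ∏' n, blaschkeFactor (a n) z :=
  ⟨differentiableOn_tprod_blaschkeFactor ha hs, 1, fun _ hz =>
    norm_tprod_blaschkeFactor_le ha hs (mem_ball_zero_iff.1 hz)⟩

/-- Weierstrass's product inequality; the induction uses that the partial products are at most one.
-/
lemma one_sub_sum_le_prod {ι : Type*} (s : Finset ι) {x : ι → ℝ} (h0 : ∀ i, 0 ≤ x i)
    (h1 : ∀ i, x i ≤ 1) : 1 - ∑ i ∈ s, (1 - x i) ≤ ∏ i ∈ s, x i := by
  classical
  induction s using Finset.induction_on with
  | empty => simp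
  | insert i s hi ih =>
    rw [Finset.sum_insert hi, Finset.prod_insert hi]
    have h2 : ∏ i ∈ s, x i ≤ 1 := Finset.prod_le_one (fun i _ => h0 i) fun i _ => h1 i
    nlinarith [h0 i, h1 i]

lemma one_sub_tsum_le_tprod_zero (ha : ∀ n, ‖a n‖ < 1) (hs : Summable fun n => 1 - ‖a n‖) :
    1 - ∑' n, (1 - ‖a n‖) ≤ (∏' n, blaschkeFactor (a n) 0).re := by
  have hm := (multipliable_blaschkeFactor ha hs (z := 0) (by simp)).hasProd
  refine ge_of_tendsto (Complex.continuous_re.tendsto _ |>.comp hm)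
    (Eventually.of_forall fun s => ?_)
  simp only [Function.comp, blaschkeFactor_zero]
  rw [← Complex.ofReal_prod, Complex.ofReal_re]
  have := one_sub_sum_le_prod s (x := fun n => ‖a n‖) (fun _ => norm_nonneg _) fun n => (ha n).le
  have h2 := hs.sum_le_tsum s (fun n _ => by linarith [ha n])
  linarith

/-- The partial Blaschke product. -/
def blaschkePartial (c : ℂ) (a : ℕ → ℂ) (N : ℕ) (z : ℂ) : ℂ :=
  c * ∏ n ∈ Finset.range N, blaschkeFactor (a n) z

/-- The tail of a Blaschke product. -/
def blaschkeTail (a : ℕ → ℂ) (N : ℕ) (z : ℂ) : ℂ :=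
  ∏' n, blaschkeFactor (a (n + N)) z

lemma blaschkePartial_mul_blaschkeTail (c : ℂ) (ha : ∀ n, ‖a n‖ < 1)
    (hs : Summable fun n => 1 - ‖a n‖) (N : ℕ) {z : ℂ} (hz : ‖z‖ < 1) :
    blaschkePartial c a N z * blaschkeTail a N z = blaschkeProduct c a z := by
  have := (multipliable_blaschkeFactor (a := fun n => a (n + N)) (fun _ => ha _)
    ((summable_nat_add_iff N).2 hs) hz).prod_mul_tprod_nat_mul'
    (f := fun n => blaschkeFactor (a n) z)
  rw [blaschkePartial, blaschkeTail, blaschkeProduct, mul_assoc, this]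

lemma isHInf_blaschkeTail (ha : ∀ n, ‖a n‖ < 1) (hs : Summable fun n => 1 - ‖a n‖) (N : ℕ) :
    IsHInf (blaschkeTail a N) :=
  isHInf_tprod_blaschkeFactor (a := fun n => a (n + N)) (fun _ => ha _)
    ((summable_nat_add_iff N).2 hs)

lemma norm_blaschkeTail_le (ha : ∀ n, ‖a n‖ < 1) (hs : Summable fun n => 1 - ‖a n‖) (N : ℕ)
    {z : ℂ} (hz : z ∈ Metric.ball (0 : ℂ) 1) : ‖blaschkeTail a N z‖ ≤ 1 :=
  norm_tprod_blaschkeFactor_le (a := fun n => a (n + N)) (fun _ => ha _)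
    ((summable_nat_add_iff N).2 hs) (mem_ball_zero_iff.1 hz)

/-- At the origin each factor equals `‖a n‖`, so the defect is at most a tail of the convergent sum.
Both boundary arguments below rest on this smallness. -/
lemma tendsto_one_sub_re_blaschkeTail (ha : ∀ n, ‖a n‖ < 1)
    (hs : Summable fun n => 1 - ‖a n‖) :
    Tendsto (fun N => 1 - (blaschkeTail a N 0).re) atTop (𝓝 0) := by
  refine squeeze_zero (fun N => ?_) (fun N => ?_)
    (tendsto_sum_nat_add fun n => 1 - ‖a n‖)
  · have := norm_blaschkeTail_le ha hs N (Metric.mem_ball_self one_pos)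
    linarith [Complex.re_le_norm (blaschkeTail a N 0)]
  · have := one_sub_tsum_le_tprod_zero (a := fun n => a (n + N)) (fun _ => ha _)
      ((summable_nat_add_iff N).2 hs)
    rw [blaschkeTail]
    linarith

lemma norm_blaschkePartial {c : ℂ} (hc : ‖c‖ = 1) (ha : ∀ n, ‖a n‖ < 1) (N : ℕ) {z : ℂ}
    (hz : ‖z‖ = 1) : ‖blaschkePartial c a N z‖ = 1 := by
  rw [blaschkePartial, norm_mul, hc, one_mul, norm_prod]
  exact Finset.prod_eq_one fun n _ => norm_blaschkeFactor_of_norm_eq_one (ha n) hz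

lemma continuousAt_blaschkePartial (c : ℂ) (ha : ∀ n, ‖a n‖ < 1) (N : ℕ) {z : ℂ}
    (hz : ‖z‖ ≤ 1) : ContinuousAt (blaschkePartial c a N) z := by
  unfold blaschkePartial
  exact continuousAt_const.mul
    (tendsto_finsetProd _ fun n _ => (differentiableAt_blaschkeFactor (ha n) hz).continuousAt)

lemma blaschkePartial_ne_zero {c : ℂ} (hc : ‖c‖ = 1) (ha : ∀ n, ‖a n‖ < 1) (N : ℕ) {z : ℂ}
    (hz : ‖z‖ = 1) : blaschkePartial c a N z ≠ 0 :=
  norm_ne_zero_iff.1 (by rw [norm_blaschkePartial hc ha N hz]; exact one_ne_zero)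

/-- If `f` is the product of a partial Blaschke product with `h`, then radial limits of `f` give
radial limits of `h`. -/
lemma HasRadialLimit.div_blaschkePartial {c : ℂ} (hc : ‖c‖ = 1) (ha : ∀ n, ‖a n‖ < 1) (N : ℕ)
    {f h : ℂ → ℂ} (hfh : ∀ z ∈ Metric.ball (0 : ℂ) 1, f z = blaschkePartial c a N z * h z)
    {ζ u : ℂ} (hζ : ‖ζ‖ = 1) (hu : HasRadialLimit f ζ u) :
    HasRadialLimit h ζ (u / blaschkePartial c a N ζ) := by
  have hne := blaschkePartial_ne_zero hc ha N hζ
  have hP := hasRadialLimit_of_continuousAt (continuousAt_blaschkePartial c ha N hζ.le)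
  refine Tendsto.congr' ?_ (Tendsto.div hu hP hne)
  filter_upwards [eventually_mul_mem_ball hζ, Tendsto.eventually_ne hP hne] with r hr hr0
  rw [Pi.div_apply, hfh _ hr, mul_div_cancel_left₀ _ hr0]

/-- The finite product is continuous and nonzero on the circle, so one set of radial limits of the
full product serves all tails at once. -/
lemma HasBoundaryValues.tail_of_blaschkeProduct {c : ℂ} (hc : ‖c‖ = 1) (ha : ∀ n, ‖a n‖ < 1)
    (hs : Summable fun n => 1 - ‖a n‖) {b : ℝ → ℂ}
    (hb : HasBoundaryValues (blaschkeProduct c a) b) (N : ℕ) :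
    HasBoundaryValues (blaschkeTail a N)
      fun t => b t / blaschkePartial c a N (Complex.exp (t * Complex.I)) := by
  filter_upwards [hb.ae] with t ht
  exact ht.div_blaschkePartial hc ha N (fun z hz =>
    (blaschkePartial_mul_blaschkeTail c ha hs N (mem_ball_zero_iff.1 hz)).symm)
    (Complex.norm_exp_ofReal_mul_I t)

/-- The radial limits of a Blaschke product are unimodular. -/
lemma HasBoundaryValues.norm_blaschkeProduct {c : ℂ} (hc : ‖c‖ = 1) (ha : ∀ n, ‖a n‖ < 1)
    (hs : Summable fun n => 1 - ‖a n‖) {b : ℝ → ℂ}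
    (hb : HasBoundaryValues (blaschkeProduct c a) b) : ∀ᵐ t ∂arcMeasure, ‖b t‖ = 1 := by
  have hnorm : ∀ N (t : ℝ),
      ‖b t / blaschkePartial c a N (Complex.exp (t * Complex.I))‖ = ‖b t‖ := fun N t => by
    rw [norm_div, norm_blaschkePartial hc ha N (Complex.norm_exp_ofReal_mul_I t), div_one]
  have hle : ∀ᵐ t ∂arcMeasure, ‖b t‖ ≤ 1 := by
    filter_upwards [(hb.tail_of_blaschkeProduct hc ha hs 0).norm_le
      fun z hz => norm_blaschkeTail_le ha hs 0 hz] with t ht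
    rwa [hnorm] at ht
  have hint : Integrable (fun t => ‖b t‖) arcMeasure := by
    refine ((hb.tail_of_blaschkeProduct hc ha hs 0).integrable (isHInf_blaschkeTail ha hs 0)).norm.congr
      (Eventually.of_forall fun t => hnorm 0 t)
  -- Every tail has boundary modulus `‖b t‖`, so its mean value at `0` bounds `∫ ‖b‖` from below; `N
  -- → ∞` then forces `∫ (1 - ‖b‖) = 0`.
  have hle2 : ∀ N, ∫ t, (1 - ‖b t‖) ∂arcMeasure ≤ 1 - (blaschkeTail a N 0).re := by
    intro N
    have h1 := (hb.tail_of_blaschkeProduct hc ha hs N).integral_eq (isHInf_blaschkeTail ha hs N)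
    have h2 := norm_integral_le_integral_norm (μ := arcMeasure)
      fun t : ℝ => b t / blaschkePartial c a N (Complex.exp (t * Complex.I))
    rw [h1] at h2
    simp only [hnorm] at h2
    rw [integral_sub (integrable_const _) hint]
    simp only [integral_const, probReal_univ, smul_eq_mul, mul_one]
    linarith [Complex.re_le_norm (blaschkeTail a N 0)]
  have h0 : ∫ t, (1 - ‖b t‖) ∂arcMeasure = 0 := by
    refine le_antisymm (ge_of_tendsto (tendsto_one_sub_re_blaschkeTail ha hs)
      (Eventually.of_forall hle2)) (integral_nonneg_of_ae ?_)
    filter_upwards [hle] with t ht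
    simpa using ht
  have := (integral_eq_zero_iff_of_nonneg_ae
    (by filter_upwards [hle] with t ht; simpa using ht) ((integrable_const _).sub hint)).1 h0
  filter_upwards [this] with t ht
  simp only [Pi.zero_apply, Pi.sub_apply] at ht
  linarith

end InfiniteProduct

/-! ### Division by zeros. -/

/-- A zero of a bounded analytic function can be divided out by a Blaschke factor. -/
lemma IsHInf.exists_eq_blaschkeFactor_mul {f : ℂ → ℂ} (hf : IsHInf f) {a : ℂ}
    (ha : a ∈ Metric.ball (0 : ℂ) 1) (h0 : f a = 0) :
    ∃ g, IsHInf g ∧ ∀ z ∈ Metric.ball (0 : ℂ) 1, f z = blaschkeFactor a z * g z := by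
  obtain ⟨hd, C, hC⟩ := hf
  have ha1 : ‖a‖ < 1 := mem_ball_zero_iff.1 ha
  have hσ : blaschkeSign a ≠ 0 :=
    norm_ne_zero_iff.1 (by rw [norm_blaschkeSign]; exact one_ne_zero)
  have hds : DifferentiableOn ℂ (dslope f a) (Metric.ball 0 1) :=
    (Complex.differentiableOn_dslope (Metric.isOpen_ball.mem_nhds ha)).2 hd
  have hC0 : 0 ≤ C := (norm_nonneg _).trans (hC a ha)
  have hH : IsHInf (dslope f a) := by
    refine ⟨hds, ?_⟩
    set δ := (1 - ‖a‖) / 2 with hδ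
    have hδ0 : 0 < δ := by rw [hδ]; linarith
    have hsub : Metric.closedBall a δ ⊆ Metric.ball 0 1 := by
      intro w hw
      rw [mem_closedBall_iff_norm] at hw
      rw [mem_ball_zero_iff]
      have := norm_sub_norm_le w a
      linarith
    obtain ⟨D, hD⟩ := (isCompact_closedBall a δ).exists_bound_of_continuousOn
      (hds.continuousOn.mono hsub)
    -- Compactness bounds the slope near `a`; elsewhere its denominator exceeds `δ`.
    refine ⟨max D (C / δ), fun z hz => ?_⟩
    by_cases hza : z ∈ Metric.closedBall a δ
    · exact (hD z hza).trans (le_max_left _ _)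
    · refine le_trans ?_ (le_max_right _ _)
      rw [mem_closedBall_iff_norm, not_le] at hza
      have hne : z ≠ a := by
        rintro rfl
        simp at hza
        linarith
      rw [dslope_of_ne _ hne, slope_def_field, h0, sub_zero, norm_div]
      have := hC z hz
      gcongr
  refine ⟨fun z => (blaschkeSign a)⁻¹ * ((1 - (starRingEnd ℂ) a * z) * dslope f a z),
    (((isHInf_const 1).sub (isHInf_id.const_mul _)).mul hH).const_mul _, fun z hz => ?_⟩
  have hne := one_sub_conj_mul_ne_zero ha1 (mem_ball_zero_iff.1 hz).le
  have h1 : f z = (z - a) * dslope f a z := by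
    have := sub_smul_dslope f a z
    rw [h0, sub_zero, smul_eq_mul] at this
    exact this.symm
  rw [h1, blaschkeFactor_eq, mul_mul_mul_comm, mul_inv_cancel₀ hσ, one_mul,
    ← mul_assoc, div_mul_cancel₀ _ hne]

/-- Since the zeros are distinct, the factors already removed do not vanish at `a N`, so the
quotient does and can be divided again. -/
lemma IsHInf.exists_eq_blaschkePartial_mul {f : ℂ → ℂ} (hf : IsHInf f) {a : ℕ → ℂ}
    (ha : ∀ n, a n ∈ Metric.ball (0 : ℂ) 1) (hinj : Function.Injective a)
    (h0 : ∀ n, f (a n) = 0) {c : ℂ} (hc : c ≠ 0) (N : ℕ) :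
    ∃ g, IsHInf g ∧ ∀ z ∈ Metric.ball (0 : ℂ) 1, f z = blaschkePartial c a N z * g z := by
  have ha1 : ∀ n, ‖a n‖ < 1 := fun n => mem_ball_zero_iff.1 (ha n)
  induction N with
  | zero =>
    refine ⟨fun z => c⁻¹ * f z, hf.const_mul _, fun z _ => ?_⟩
    simp [blaschkePartial, hc]
  | succ N ih =>
    obtain ⟨g, hg, hfg⟩ := ih
    have hgN : g (a N) = 0 := by
      have h := hfg _ (ha N)
      rw [h0] at h
      refine (mul_eq_zero.1 h.symm).resolve_left (mul_ne_zero hc (Finset.prod_ne_zero_iff.2 ?_))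
      intro n hn
      rw [Ne, blaschkeFactor_eq_zero_iff (ha1 n) (ha1 N).le]
      exact fun h => (Finset.mem_range.1 hn).ne' (hinj h)
    obtain ⟨k, hk, hgk⟩ := hg.exists_eq_blaschkeFactor_mul (ha N) hgN
    refine ⟨k, hk, fun z hz => ?_⟩
    rw [hfg z hz, hgk z hz, blaschkePartial, blaschkePartial, Finset.prod_range_succ]
    ring

/-! ### Schwarz–Pick. -/

lemma norm_mobius_lt {a z : ℂ} (ha : ‖a‖ < 1) (hz : ‖z‖ < 1) :
    ‖(z - a) / (1 - (starRingEnd ℂ) a * z)‖ < 1 := by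
  have h := normSq_one_sub_conj_mul_sub a z
  have h1 : 0 < 1 - ‖a‖ ^ 2 := by nlinarith [norm_nonneg a]
  have h2 : 0 < 1 - ‖z‖ ^ 2 := by nlinarith [norm_nonneg z]
  have := mul_pos h1 h2
  rw [norm_div, div_lt_one (norm_pos_iff.2 (one_sub_conj_mul_ne_zero ha hz.le))]
  refine (sq_lt_sq₀ (norm_nonneg _) (norm_nonneg _)).1 ?_
  linarith

lemma mobius_neg_mobius {a z : ℂ} (ha : ‖a‖ < 1) (hz : ‖z‖ < 1) :
    ((z - a) / (1 - (starRingEnd ℂ) a * z) - -a) /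
      (1 - (starRingEnd ℂ) (-a) * ((z - a) / (1 - (starRingEnd ℂ) a * z))) = z := by
  have h1 := one_sub_conj_mul_ne_zero ha hz.le
  have h2 := one_sub_conj_mul_ne_zero ha ha.le
  have e1 : (z - a) / (1 - (starRingEnd ℂ) a * z) - -a
      = z * (1 - (starRingEnd ℂ) a * a) / (1 - (starRingEnd ℂ) a * z) := by
    rw [eq_div_iff h1, sub_neg_eq_add, add_mul, div_mul_cancel₀ _ h1]
    ring
  have e2 : 1 - (starRingEnd ℂ) (-a) * ((z - a) / (1 - (starRingEnd ℂ) a * z))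
      = (1 - (starRingEnd ℂ) a * a) / (1 - (starRingEnd ℂ) a * z) := by
    rw [eq_div_iff h1, sub_mul, mul_assoc, div_mul_cancel₀ _ h1, map_neg]
    ring
  rw [e1, e2, div_div_div_cancel_right₀ h1, mul_div_cancel_right₀ _ h2]

/-- A form of the Schwarz--Pick inequality. -/
lemma norm_sub_le_two_mul_pseudoDist {f : ℂ → ℂ}
    (hf : DifferentiableOn ℂ f (Metric.ball 0 1)) {C : ℝ}
    (hC : ∀ z ∈ Metric.ball (0 : ℂ) 1, ‖f z‖ ≤ C) {a z : ℂ} (ha : a ∈ Metric.ball (0 : ℂ) 1)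
    (hz : z ∈ Metric.ball (0 : ℂ) 1) : ‖f z - f a‖ ≤ 2 * C * pseudoDist a z := by
  have ha1 : ‖a‖ < 1 := mem_ball_zero_iff.1 ha
  have hz1 : ‖z‖ < 1 := mem_ball_zero_iff.1 hz
  have hna : ‖-a‖ < 1 := by rwa [norm_neg]
  set m : ℂ → ℂ := fun w => (w - -a) / (1 - (starRingEnd ℂ) (-a) * w) with hm
  have hmaps : Set.MapsTo m (Metric.ball 0 1) (Metric.ball 0 1) := fun w hw =>
    mem_ball_zero_iff.2 (norm_mobius_lt hna (mem_ball_zero_iff.1 hw))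
  have hmd : DifferentiableOn ℂ m (Metric.ball 0 1) := by
    intro w hw
    have := one_sub_conj_mul_ne_zero hna (mem_ball_zero_iff.1 hw).le
    refine DifferentiableAt.differentiableWithinAt ?_
    simp only [hm]
    fun_prop (disch := exact this)
  have hm0 : m 0 = a := by simp [hm]
  have hmz : m ((z - a) / (1 - (starRingEnd ℂ) a * z)) = z := mobius_neg_mobius ha1 hz1
  -- The Möbius map moves `a` to the origin. Values of `f` lie within `2 * C` of `f a`; this is the
  -- source of the `2` in `1 / (2 * M)`.
  have key := Complex.dist_le_div_mul_dist_of_mapsTo_ball (f := f ∘ m) (c := 0) (R₁ := 1)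
    (R₂ := 2 * C) (z := (z - a) / (1 - (starRingEnd ℂ) a * z)) (hf.comp hmd hmaps)
    (fun w hw => by
      rw [mem_closedBall_iff_norm]
      refine (norm_sub_le _ _).trans ?_
      have h1 := hC _ (hmaps hw)
      have h2 := hC _ (hmaps (Metric.mem_ball_self one_pos))
      simp only [Function.comp]
      linarith)
    (mem_ball_zero_iff.2 (norm_mobius_lt ha1 hz1))
  simpa [Function.comp, hm0, hmz, dist_eq_norm, pseudoDist] using key

/-! ### Linear structure of the model space and uniqueness. -/

section ModelSpace

variable {θ : ℂ → ℂ}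

lemma add_mem_modelSpaceInf {f f' : ℂ → ℂ} (hf : f ∈ modelSpaceInf θ)
    (hf' : f' ∈ modelSpaceInf θ) : (fun z => f z + f' z) ∈ modelSpaceInf θ := by
  obtain ⟨hf, g, hg, hae⟩ := hf
  obtain ⟨hf', g', hg', hae'⟩ := hf'
  refine ⟨hf.add hf', _, hg.add hg', ?_⟩
  filter_upwards [hae, hae'] with t ht ht'
  obtain ⟨u, b, v, hu, hb, hv, e⟩ := ht
  obtain ⟨u', b', v', hu', hb', hv', e'⟩ := ht'
  obtain rfl := hb.unique hb'
  refine ⟨_, b, _, hu.add hu', hb, hv.add hv', ?_⟩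
  rw [e, e', mul_add, map_add, mul_add]

lemma const_mul_mem_modelSpaceInf {f : ℂ → ℂ} (hf : f ∈ modelSpaceInf θ) (k : ℂ) :
    (fun z => k * f z) ∈ modelSpaceInf θ := by
  obtain ⟨hf, g, hg, hae⟩ := hf
  refine ⟨hf.const_mul k, _, hg.const_mul ((starRingEnd ℂ) k), ?_⟩
  filter_upwards [hae] with t ht
  obtain ⟨u, b, v, hu, hb, hv, e⟩ := ht
  refine ⟨_, b, _, hu.tendsto.const_mul k, hb, hv.tendsto.const_mul _, ?_⟩
  rw [e]
  simp only [map_mul, Complex.conj_conj]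
  ring

/-- The boundary functions attached to a member of a model space. -/
lemma exists_boundaryValues_of_mem {f : ℂ → ℂ} (hf : f ∈ modelSpaceInf θ) :
    ∃ (g : ℂ → ℂ) (u b v : ℝ → ℂ), IsHInf g ∧ ∀ᵐ t : ℝ,
      HasRadialLimit f (Complex.exp (t * Complex.I)) (u t) ∧
      HasRadialLimit θ (Complex.exp (t * Complex.I)) (b t) ∧
      HasRadialLimit g (Complex.exp (t * Complex.I)) (v t) ∧
      u t = b t * (starRingEnd ℂ) (Complex.exp (t * Complex.I) * v t) := by
  obtain ⟨-, g, hg, hae⟩ := hf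
  obtain ⟨u, hae⟩ := Filter.skolem.1 hae
  obtain ⟨b, hae⟩ := Filter.skolem.1 hae
  obtain ⟨v, hae⟩ := Filter.skolem.1 hae
  exact ⟨g, u, b, v, hg, hae⟩

/-- A member of the model space of a Blaschke product with simple zeros that vanishes at all these
zeros is zero. -/
lemma eq_zero_of_mem_modelSpaceInf_blaschkeProduct {a : ℕ → ℂ}
    (ha : ∀ n, a n ∈ Metric.ball (0 : ℂ) 1) (hs : Summable fun n => 1 - ‖a n‖) {c : ℂ}
    (hc : ‖c‖ = 1) (hinj : Function.Injective a) {f : ℂ → ℂ}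
    (hf : f ∈ modelSpaceInf (blaschkeProduct c a)) (h0 : ∀ n, f (a n) = 0) :
    ∀ z ∈ Metric.ball (0 : ℂ) 1, f z = 0 := by
  have ha1 : ∀ n, ‖a n‖ < 1 := fun n => mem_ball_zero_iff.1 (ha n)
  have hc0 : c ≠ 0 := norm_ne_zero_iff.1 (by rw [hc]; exact one_ne_zero)
  have hfH : IsHInf f := hf.1
  obtain ⟨g, u, b, v, hg, hae⟩ := exists_boundaryValues_of_mem hf
  replace hae := ae_arcMeasure_of_ae hae
  have hu : HasBoundaryValues f u := hae.mono fun t ht => ht.1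
  have hb : HasBoundaryValues (blaschkeProduct c a) b := hae.mono fun t ht => ht.2.1
  have hv : HasBoundaryValues g v := hae.mono fun t ht => ht.2.2.1
  obtain ⟨C, hC⟩ := hg.2
  have hvC := hv.norm_le hC
  have hvm := hv.aestronglyMeasurable hg
  have hv2 : Integrable (fun t => ‖v t‖ ^ 2) arcMeasure := by
    refine .of_bound (hvm.norm.pow 2) (C ^ 2) ?_
    filter_upwards [hvC] with t ht
    rw [norm_pow, norm_norm]
    gcongr
  have hle : ∀ N, ∫ t, ‖v t‖ ^ 2 ∂arcMeasure ≤ C ^ 2 * (1 - (blaschkeTail a N 0).re) := by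
    intro N
    set r : ℝ → ℂ := fun t => b t / blaschkePartial c a N (Complex.exp (t * Complex.I)) with hr
    have hrb : HasBoundaryValues (blaschkeTail a N) r :=
      hb.tail_of_blaschkeProduct hc ha1 hs N
    have hri := hrb.integrable (isHInf_blaschkeTail ha1 hs N)
    have hr1 := hrb.norm_le fun z hz => norm_blaschkeTail_le ha1 hs N hz
    obtain ⟨h, hh, hfh⟩ := hfH.exists_eq_blaschkePartial_mul ha hinj h0 hc0 N
    -- Multiplying `u / P_N` by `ζ v` turns the conjugate in `u` into `‖v‖²`. The factor `z` makes
    -- the product vanish at the origin, hence its boundary integral too.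
    have hF : HasBoundaryValues (fun z => h z * (z * g z)) fun t => r t * (‖v t‖ ^ 2 : ℝ) := by
      filter_upwards [hae] with t ⟨h1, _, h3, h4⟩
      have hζ := Complex.norm_exp_ofReal_mul_I t
      have e : r t * (‖v t‖ ^ 2 : ℝ) =
          u t / blaschkePartial c a N (Complex.exp (t * Complex.I)) *
            (Complex.exp (t * Complex.I) * v t) := by
        have h5 : (starRingEnd ℂ) (Complex.exp (t * Complex.I) * v t) *
            (Complex.exp (t * Complex.I) * v t) = ((‖v t‖ ^ 2 : ℝ) : ℂ) := by
          rw [mul_comm, Complex.mul_conj, Complex.normSq_eq_norm_sq, norm_mul, hζ, one_mul]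
        rw [h4, ← h5]
        ring
      rw [e]
      exact (h1.div_blaschkePartial hc ha1 N hfh hζ).mul
        ((hasRadialLimit_of_continuousAt continuousAt_id).mul h3)
    have hFH : IsHInf fun z => h z * (z * g z) := hh.mul (isHInf_id.mul hg)
    have hFint := hF.integral_eq hFH
    have hFi := hF.integrable hFH
    have hre : ∫ t, (r t).re * ‖v t‖ ^ 2 ∂arcMeasure = 0 := by
      have := integral_re hFi
      rw [hFint] at this
      simpa only [RCLike.re_to_complex, Complex.re_mul_ofReal, zero_mul, mul_zero,
        Complex.zero_re] using this
    have hrei : Integrable (fun t => (r t).re * ‖v t‖ ^ 2) arcMeasure := by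
      simpa only [RCLike.re_to_complex, Complex.re_mul_ofReal] using hFi.re
    have hr0 : ∫ t, (1 - (r t).re) ∂arcMeasure = 1 - (blaschkeTail a N 0).re := by
      have h1 := integral_re hri
      rw [hrb.integral_eq (isHInf_blaschkeTail ha1 hs N)] at h1
      rw [integral_sub (integrable_const _) (by simpa using hri.re)]
      simp only [RCLike.re_to_complex] at h1
      simp [h1]
    calc ∫ t, ‖v t‖ ^ 2 ∂arcMeasure
        = ∫ t, (‖v t‖ ^ 2 - (r t).re * ‖v t‖ ^ 2) ∂arcMeasure := by
          rw [integral_sub hv2 hrei, hre, sub_zero]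
      _ ≤ ∫ t, C ^ 2 * (1 - (r t).re) ∂arcMeasure := by
          refine integral_mono_ae (hv2.sub hrei)
            (((integrable_const _).sub (by simpa using hri.re)).const_mul _) ?_
          filter_upwards [hr1, hvC] with t ht1 ht2
          have h1 : 0 ≤ 1 - (r t).re := by linarith [Complex.re_le_norm (r t)]
          have h2 : ‖v t‖ ^ 2 ≤ C ^ 2 := by gcongr
          nlinarith
      _ = C ^ 2 * (1 - (blaschkeTail a N 0).re) := by rw [integral_const_mul, hr0]
  have hv0 : ∫ t, ‖v t‖ ^ 2 ∂arcMeasure = 0 := by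
    have hlim := (tendsto_one_sub_re_blaschkeTail ha1 hs).const_mul (C ^ 2)
    rw [mul_zero] at hlim
    exact le_antisymm (ge_of_tendsto hlim (Eventually.of_forall hle))
      (integral_nonneg fun t => by positivity)
  have hvz := (integral_eq_zero_iff_of_nonneg (fun t => by positivity) hv2).1 hv0
  intro z hz
  refine norm_le_zero_iff.1 (hu.norm_le_of_ae hfH ?_ hz)
  filter_upwards [hae, hvz] with t ⟨_, _, _, h4⟩ ht
  have : v t = 0 := by simpa using ht
  simp [h4, this]

/-! ### Closedness under uniform limits. -/

lemma IsHInf.of_tendstoUniformlyOn {F : ℕ → ℂ → ℂ} {f : ℂ → ℂ} (hF : ∀ k, IsHInf (F k))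
    (h : TendstoUniformlyOn F f atTop (Metric.ball 0 1)) : IsHInf f := by
  refine ⟨h.tendstoLocallyUniformlyOn.differentiableOn (.of_forall fun k => (hF k).1)
    Metric.isOpen_ball, ?_⟩
  obtain ⟨N, hN⟩ := (Metric.tendstoUniformlyOn_iff.1 h 1 one_pos).exists
  obtain ⟨C, hC⟩ := (hF N).2
  refine ⟨1 + C, fun z hz => ?_⟩
  have h1 := hN z hz
  rw [dist_eq_norm] at h1
  have h2 := norm_add_le (f z - F N z) (F N z)
  rw [sub_add_cancel] at h2
  linarith [hC z hz]

/-- Uniform estimates in the disk persist for radial limits, which are therefore Cauchy; uniformity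
allows the two limits to be interchanged. -/
lemma HasRadialLimit.of_tendstoUniformlyOn {F : ℕ → ℂ → ℂ} {f : ℂ → ℂ} {ζ : ℂ} (hζ : ‖ζ‖ = 1)
    {u : ℕ → ℂ} (hu : ∀ k, HasRadialLimit (F k) ζ (u k))
    (h : TendstoUniformlyOn F f atTop (Metric.ball 0 1)) :
    ∃ U, Tendsto u atTop (𝓝 U) ∧ HasRadialLimit f ζ U := by
  have hcau : CauchySeq u := by
    rw [Metric.cauchySeq_iff]
    intro ε hε
    obtain ⟨N, hN⟩ := Metric.uniformCauchySeqOn_iff.1 h.uniformCauchySeqOn (ε / 2) (half_pos hε)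
    refine ⟨N, fun m hm n hn => lt_of_le_of_lt ?_ (half_lt_self hε)⟩
    rw [dist_eq_norm]
    exact ((hu m).sub (hu n)).norm_le hζ fun z hz => by
      simpa [dist_eq_norm] using (hN m hm n hn z hz).le
  obtain ⟨U, hU⟩ := cauchySeq_tendsto_of_complete hcau
  refine ⟨U, hU, ?_⟩
  have h1 : TendstoUniformlyOnFilter (fun k (r : ℝ) => F k ((r : ℂ) * ζ))
      (fun r : ℝ => f ((r : ℂ) * ζ)) atTop (𝓝[<] 1) :=
    (tendstoUniformlyOn_iff_tendstoUniformlyOnFilter.1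
      (h.comp fun r : ℝ => (r : ℂ) * ζ)).mono_right
        (le_principal_iff.2 (eventually_mul_mem_ball hζ))
  exact h1.tendsto_of_eventually_tendsto (.of_forall hu) hU

/-- If `θ` has unimodular radial limits, its model space is closed under uniform limits. -/
lemma modelSpaceInf_of_tendstoUniformlyOn
    (hθ : ∀ b, HasBoundaryValues θ b → ∀ᵐ t ∂arcMeasure, ‖b t‖ = 1)
    {F : ℕ → ℂ → ℂ} {f : ℂ → ℂ} (hF : ∀ k, F k ∈ modelSpaceInf θ)
    (h : TendstoUniformlyOn F f atTop (Metric.ball 0 1)) : f ∈ modelSpaceInf θ := by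
  choose g u b v hg hae using fun k => exists_boundaryValues_of_mem (hF k)
  -- On the circle `‖v m - v n‖ = ‖u m - u n‖` because `θ` is unimodular there; the maximum
  -- principle carries the bound into the disk.
  have hcau : UniformCauchySeqOn g atTop (Metric.ball 0 1) := by
    rw [Metric.uniformCauchySeqOn_iff]
    intro ε hε
    obtain ⟨N, hN⟩ := Metric.uniformCauchySeqOn_iff.1 h.uniformCauchySeqOn (ε / 2) (half_pos hε)
    refine ⟨N, fun m hm n hn z hz => lt_of_le_of_lt ?_ (half_lt_self hε)⟩
    have hm' := ae_arcMeasure_of_ae (hae m)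
    have hn' := ae_arcMeasure_of_ae (hae n)
    have hbv : HasBoundaryValues (fun z => g m z - g n z) fun t => v m t - v n t := by
      filter_upwards [hm', hn'] with t h1 h2
      exact h1.2.2.1.sub h2.2.2.1
    rw [dist_eq_norm]
    refine hbv.norm_le_of_ae ((hg m).sub (hg n)) ?_ hz
    filter_upwards [hm', hn', hθ (b m) (hm'.mono fun t ht => ht.2.1)]
      with t ⟨h1, h2, _, h4⟩ ⟨h1', h2', _, h4'⟩ h5
    have hζ := Complex.norm_exp_ofReal_mul_I t
    have hle : ‖u m t - u n t‖ ≤ ε / 2 := (h1.sub h1').norm_le hζ fun z hz => by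
      simpa [dist_eq_norm] using (hN m hm n hn z hz).le
    rwa [h4, h4', ← h2.unique h2', ← mul_sub, ← map_sub, ← mul_sub, norm_mul, h5, one_mul,
      RCLike.norm_conj, norm_mul, hζ, one_mul] at hle
  have hlim : ∀ z ∈ Metric.ball (0 : ℂ) 1, ∃ w, Tendsto (fun k => g k z) atTop (𝓝 w) :=
    fun z hz => cauchySeq_tendsto_of_complete (hcau.cauchySeq hz)
  choose! G hG using hlim
  have hgG := hcau.tendstoUniformlyOn_of_tendsto hG
  refine ⟨IsHInf.of_tendstoUniformlyOn (fun k => (hF k).1) h, G, .of_tendstoUniformlyOn hg hgG, ?_⟩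
  filter_upwards [ae_all_iff.2 hae] with t ht
  have hζ := Complex.norm_exp_ofReal_mul_I t
  obtain ⟨U, hU, hfU⟩ := HasRadialLimit.of_tendstoUniformlyOn hζ (fun k => (ht k).1) h
  obtain ⟨V, hV, hGV⟩ := HasRadialLimit.of_tendstoUniformlyOn hζ (fun k => (ht k).2.2.1) hgG
  refine ⟨U, b 0 t, V, hfU, (ht 0).2.1, hGV, tendsto_nhds_unique hU ?_⟩
  have h1 : Tendsto (fun k => b 0 t * (starRingEnd ℂ) (Complex.exp (t * Complex.I) * v k t)) atTop
      (𝓝 (b 0 t * (starRingEnd ℂ) (Complex.exp (t * Complex.I) * V))) :=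
    ((Complex.continuous_conj.tendsto _).comp (hV.const_mul _)).const_mul _
  refine h1.congr fun k => ?_
  rw [(ht k).2.2.2, (ht 0).2.1.unique (ht k).2.1]

/-! ### The model space as a Banach space and its evaluation operators. -/

open BoundedContinuousFunction

/-- The restrictions to the disk of the members of a model space, as a subspace of the space of
bounded continuous functions. -/
def modelSubmodule (θ : ℂ → ℂ) (h : (modelSpaceInf θ).Nonempty) :
    Submodule ℂ (Metric.ball (0 : ℂ) 1 →ᵇ ℂ) where
  carrier := {φ | ∃ f ∈ modelSpaceInf θ, ∀ z, φ z = f z}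
  -- For arbitrary `θ` even the zero function belongs only if `θ` has radial limits almost
  -- everywhere; scaling a known member by `0` provides them.
  zero_mem' := by
    obtain ⟨f, hf⟩ := h
    exact ⟨_, const_mul_mem_modelSpaceInf hf 0, fun z => by simp⟩
  add_mem' := by
    rintro φ ψ ⟨f, hf, hφ⟩ ⟨g, hg, hψ⟩
    exact ⟨_, add_mem_modelSpaceInf hf hg, fun z => by simp [hφ, hψ]⟩
  smul_mem' := by
    rintro k φ ⟨f, hf, hφ⟩
    exact ⟨_, const_mul_mem_modelSpaceInf hf k, fun z => by simp [hφ]⟩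

lemma isClosed_modelSubmodule (h : (modelSpaceInf θ).Nonempty)
    (hθ : ∀ b, HasBoundaryValues θ b → ∀ᵐ t ∂arcMeasure, ‖b t‖ = 1) :
    IsClosed (modelSubmodule θ h : Set (Metric.ball (0 : ℂ) 1 →ᵇ ℂ)) := by
  refine IsSeqClosed.isClosed fun φ ψ hφ hlim => ?_
  choose F hF hφF using hφ
  refine ⟨Function.extend Subtype.val ψ 0, modelSpaceInf_of_tendstoUniformlyOn hθ hF ?_,
    fun z => (Subtype.val_injective.extend_apply ψ 0 z).symm⟩
  rw [Metric.tendstoUniformlyOn_iff]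
  intro ε hε
  filter_upwards [Metric.tendstoUniformly_iff.1
    (BoundedContinuousFunction.tendsto_iff_tendstoUniformly.1 hlim) ε hε] with k hk z hz
  have := hk ⟨z, hz⟩
  rw [hφF] at this
  rwa [← Subtype.val_injective.extend_apply ψ 0 ⟨z, hz⟩] at this

lemma exists_mem_modelSubmodule (h : (modelSpaceInf θ).Nonempty) {f : ℂ → ℂ}
    (hf : f ∈ modelSpaceInf θ) : ∃ φ : modelSubmodule θ h, ∀ z, φ.1 z = f z := by
  obtain ⟨C, hC⟩ := hf.1.2
  exact ⟨⟨.ofNormedAddCommGroup (fun z => f z) hf.1.1.continuousOn.domRestrict C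
    fun z => hC z z.2, f, hf, fun _ => rfl⟩, fun _ => rfl⟩

/-- The evaluation of the members of a model space along a sequence in the disk. -/
def modelEval (h : (modelSpaceInf θ).Nonempty) (w : ℕ → ℂ)
    (hw : ∀ n, w n ∈ Metric.ball (0 : ℂ) 1) : modelSubmodule θ h →L[ℂ] (ℕ →ᵇ ℂ) :=
  LinearMap.mkContinuous
    { toFun := fun φ => φ.1.compContinuous ⟨fun n => ⟨w n, hw n⟩, continuous_of_discreteTopology⟩
      map_add' := fun _ _ => rfl
      map_smul' := fun _ _ => rfl } 1 fun φ => by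
    rw [one_mul]
    exact (BoundedContinuousFunction.norm_le (norm_nonneg _)).2 fun n => φ.1.norm_coe_le_norm _

@[simp]
lemma modelEval_apply (h : (modelSpaceInf θ).Nonempty) (w : ℕ → ℂ)
    (hw : ∀ n, w n ∈ Metric.ball (0 : ℂ) 1) (φ : modelSubmodule θ h) (n : ℕ) :
    modelEval h w hw φ n = φ.1 ⟨w n, hw n⟩ := rfl

lemma isInterpolatingFor_iff_surjective_modelEval (h : (modelSpaceInf θ).Nonempty) (w : ℕ → ℂ)
    (hw : ∀ n, w n ∈ Metric.ball (0 : ℂ) 1) :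
    IsInterpolatingFor (modelSpaceInf θ) w ↔ Function.Surjective (modelEval h w hw) := by
  constructor
  · intro hi α
    obtain ⟨f, hf, hfα⟩ := hi α ⟨‖α‖, α.norm_coe_le_norm⟩
    obtain ⟨φ, hφ⟩ := exists_mem_modelSubmodule h hf
    exact ⟨φ, by ext n; simp [hφ, hfα]⟩
  · rintro hsurj α ⟨C, hC⟩
    obtain ⟨φ, hφ⟩ := hsurj
      (.ofNormedAddCommGroup α continuous_of_discreteTopology C hC)
    obtain ⟨f, hf, hφf⟩ := φ.2
    refine ⟨f, hf, fun n => ?_⟩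
    have := DFunLike.congr_fun hφ n
    rwa [modelEval_apply, hφf] at this

/-- Data equal to `1` at one index and `0` elsewhere separate the points, so an interpolated
Blaschke product has simple zeros. -/
lemma IsInterpolatingFor.injective {X : Set (ℂ → ℂ)} {a : ℕ → ℂ} (h : IsInterpolatingFor X a) :
    Function.Injective a := by
  intro m n hmn
  by_contra hne
  obtain ⟨f, -, hf⟩ := h (Pi.single m 1) ⟨1, fun k => by
    rcases eq_or_ne k m with rfl | hk
    · simp
    · simp [hk]⟩
  have h1 := hf m
  rw [hmn, hf n] at h1
  simp [Ne.symm hne] at h1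

lemma norm_eq_hInfNorm {f : ℂ → ℂ} {φ : Metric.ball (0 : ℂ) 1 →ᵇ ℂ} (h : ∀ z, φ z = f z) :
    ‖φ‖ = hInfNorm f := by
  rw [BoundedContinuousFunction.norm_eq_iSup_norm, hInfNorm]
  simp only [h]

lemma norm_modelEval (h : (modelSpaceInf θ).Nonempty) {w : ℕ → ℂ}
    (hw : ∀ n, w n ∈ Metric.ball (0 : ℂ) 1) {φ : modelSubmodule θ h} {f : ℂ → ℂ}
    (hφ : ∀ z, φ.1 z = f z) : ‖modelEval h w hw φ‖ = ⨆ n, ‖f (w n)‖ := by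
  rw [BoundedContinuousFunction.norm_eq_iSup_norm]
  simp [hφ]

lemma norm_modelEval_sub_le (h : (modelSpaceInf θ).Nonempty) {a z : ℕ → ℂ}
    (ha : ∀ n, a n ∈ Metric.ball (0 : ℂ) 1) (hz : ∀ n, z n ∈ Metric.ball (0 : ℂ) 1) {δ : ℝ}
    (hδ : ∀ n, pseudoDist (a n) (z n) ≤ δ) (φ : modelSubmodule θ h) :
    ‖modelEval h a ha φ - modelEval h z hz φ‖ ≤ 2 * δ * ‖φ‖ := by
  have hδ0 : 0 ≤ δ := (norm_nonneg _).trans (hδ 0)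
  refine (BoundedContinuousFunction.norm_le (by positivity)).2 fun n => ?_
  obtain ⟨f, hf, hφ⟩ := φ.2
  have := norm_sub_le_two_mul_pseudoDist hf.1.1 (C := ‖φ‖)
    (fun w hw => by rw [← hφ ⟨w, hw⟩]; exact φ.1.norm_coe_le_norm _) (ha n) (hz n)
  simp only [BoundedContinuousFunction.coe_sub, Pi.sub_apply, modelEval_apply, hφ]
  rw [norm_sub_rev]
  refine this.trans ?_
  have h1 := hδ n
  calc 2 * ‖φ‖ * pseudoDist (a n) (z n) ≤ 2 * ‖φ‖ * δ := by gcongr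
    _ = 2 * δ * ‖φ‖ := by ring

end ModelSpace

/-! ### Perturbation and conclusion. -/

lemma norm_le_norm_symm_mul {E F : Type*} [NormedAddCommGroup E] [NormedSpace ℂ E]
    [NormedAddCommGroup F] [NormedSpace ℂ F] (T : E ≃L[ℂ] F) (x : E) :
    ‖x‖ ≤ ‖T.symm.toContinuousLinearMap‖ * ‖T x‖ := by
  simpa using T.symm.toContinuousLinearMap.le_opNorm (T x)

/-- A small perturbation of an isomorphism onto a Banach space is surjective. -/
lemma surjective_of_norm_sub_le {E F : Type*} [NormedAddCommGroup E] [NormedSpace ℂ E]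
    [NormedAddCommGroup F] [NormedSpace ℂ F] [CompleteSpace F] (T : E ≃L[ℂ] F) (S : E →L[ℂ] F)
    {q : ℝ} (hq0 : 0 ≤ q) (hq : q < 1) (h : ∀ x, ‖T x - S x‖ ≤ q * ‖T x‖) :
    Function.Surjective S := by
  -- The hypothesis says that `S ∘ T⁻¹` is within `q < 1` of the identity, hence invertible by a
  -- Neumann series.
  set A : F →L[ℂ] F := S.comp (T.symm : F →L[ℂ] E) with hA
  have hn : ‖1 - A‖ < 1 := by
    refine lt_of_le_of_lt (ContinuousLinearMap.opNorm_le_bound _ hq0 fun y => ?_) hq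
    simpa [hA] using h (T.symm y)
  have hu : IsUnit A := by
    simpa using (Units.oneSub (1 - A) hn).isUnit
  obtain ⟨e, he⟩ := hu
  intro y
  refine ⟨T.symm ((e⁻¹ : (F →L[ℂ] F)ˣ).1 y), ?_⟩
  have h1 : (e.1 * (e⁻¹ : (F →L[ℂ] F)ˣ).1) y = y := by simp [e.mul_inv]
  rw [he] at h1
  exact h1

theorem theorem4p2 (a : ℕ → ℂ) (ha : ∀ n, a n ∈ Metric.ball (0 : ℂ) 1)
    (hsum : Summable (fun n => 1 - ‖a n‖)) (c : ℂ) (hc : ‖c‖ = 1)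
    (hint : IsInterpolatingFor (modelSpaceInf (blaschkeProduct c a)) a) :
    (∃ M : ℝ, IsBoundedInverseConst (modelSpaceInf (blaschkeProduct c a)) a M) ∧
    ∀ M : ℝ, IsBoundedInverseConst (modelSpaceInf (blaschkeProduct c a)) a M →
      ∀ (ε : ℝ) (z : ℕ → ℂ), (∀ n, z n ∈ Metric.ball (0 : ℂ) 1) → Function.Injective z →
        (∀ n, pseudoDist (a n) (z n) < 1 - ε) → 1 - ε < 1 / (2 * M) →
        IsInterpolatingFor (modelSpaceInf (blaschkeProduct c a)) z := by
  have hne : (modelSpaceInf (blaschkeProduct c a)).Nonempty := by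
    obtain ⟨f, hf, -⟩ := hint 0 ⟨0, fun n => by simp⟩
    exact ⟨f, hf⟩
  have hcl := isClosed_modelSubmodule hne fun b hb =>
    hb.norm_blaschkeProduct hc (fun n => mem_ball_zero_iff.1 (ha n)) hsum
  have : CompleteSpace (modelSubmodule (blaschkeProduct c a) hne) := hcl.completeSpace_coe
  have hker : (modelEval hne a ha).ker = ⊥ := by
    refine (Submodule.eq_bot_iff _).2 fun φ hφ => ?_
    obtain ⟨f, hf, hφf⟩ := φ.2
    have h0 : ∀ n, f (a n) = 0 := fun n => by
      have := DFunLike.congr_fun (LinearMap.mem_ker.1 hφ) n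
      rw [← hφf ⟨a n, ha n⟩]
      exact this
    have hz := eq_zero_of_mem_modelSpaceInf_blaschkeProduct ha hsum hc hint.injective hf h0
    ext w
    rw [hφf, hz w w.2]
    rfl
  have hsurj := (isInterpolatingFor_iff_surjective_modelEval hne a ha).1 hint
  obtain ⟨T, hTa⟩ : ∃ T : modelSubmodule (blaschkeProduct c a) hne ≃L[ℂ]
      BoundedContinuousFunction ℕ ℂ, ∀ φ, T φ = modelEval hne a ha φ :=
    ⟨ContinuousLinearEquiv.ofBijective (modelEval hne a ha) hker
      (LinearMap.range_eq_top.2 hsurj), fun φ => rfl⟩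
  refine ⟨⟨‖T.symm.toContinuousLinearMap‖, ?_⟩, ?_⟩
  · intro f hf
    obtain ⟨φ, hφ⟩ := exists_mem_modelSubmodule hne hf
    rw [← norm_eq_hInfNorm hφ, ← norm_modelEval hne ha hφ, ← hTa]
    exact norm_le_norm_symm_mul T φ
  · intro M hM ε z hz _ hρ hε
    -- A pseudohyperbolic distance is nonnegative, so `1 - ε > 0`; the bound by `1 / (2 * M)` then
    -- forces `M > 0`.
    have hδ : 0 < 1 - ε := lt_of_le_of_lt (norm_nonneg _) (hρ 0)
    have hM0 : 0 < M := by
      have := one_div_pos.1 (hδ.trans hε)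
      linarith
    rw [lt_div_iff₀ (by positivity)] at hε
    refine (isInterpolatingFor_iff_surjective_modelEval hne z hz).2
      -- This `q` combines the Schwarz–Pick factor `2 * (1 - ε)` with `‖φ‖ ≤ M * ‖T φ‖`.
      (surjective_of_norm_sub_le T _ (q := 2 * (1 - ε) * M) (by positivity) (by linarith)
        fun φ => ?_)
    obtain ⟨f, hf, hφ⟩ := φ.2
    have h1 := hM f hf
    rw [← norm_eq_hInfNorm hφ, ← norm_modelEval hne ha hφ] at h1
    rw [hTa]
    refine (norm_modelEval_sub_le hne ha hz (fun n => (hρ n).le) φ).trans ?_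
    rw [mul_assoc _ M _]
    exact mul_le_mul_of_nonneg_left h1 (by positivity)

end
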